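/- Consider finite Markov decision processes $(S,A,R,P,\gamma)$ with $S,A$ finite, $0\le\gamma<1$, together with an initial distribution $\rho_0$ on $S$ and a stationary policy $\pi$. On $S\times A$ put $\rho_0(s,a)=\rho_0(s)\pi(a|s)$ and $P_\pi(s',a'|s,a)=P(s'|s,a)\pi(a'|s')$. Let $\rho_\pi(s,a)=\sum_{t\ge 0}\gamma^t\,\mathbb P(s_t=s,a_t=a\mid s_0\sim\rho_0,\pi)$ be the occupancy measure. Let $T_\pi(i,j)\in[0,\infty]$ be the mean first-hitting time of $i$ from $j$ (with $T_\pi(i,i)=0$) for the Markov chain on $S\times A$ with transition probabilities $\tilde P_\pi(x'|x)=(1-\gamma)\rho_0(x')+\gamma P_\pi(x'|x)$. Each such MDP thus gives a triple $(S\times A,\,(1-\gamma)\rho_\pi,\,T_\pi)$. For two MDPs with triples $(\mathcal X,(1-\gamma_1)\rho_{\mathcal X},T_{\mathcal X})$ and $(\mathcal Y,(1-\gamma_2)\rho_{\mathcal Y},T_{\mathcal Y})$ let $$\mathcal{GW}=\min_\mu \frac12\Big[\sum_{(x,y)}\sum_{(x',y')}|T_{\mathcal X}(x,x')-T_{\mathcal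 Y}(y,y')|^2\mu(x,y)\mu(x',y')\Big]^{1/2},$$ where $\mu\ge 0$ ranges over the functions on $\mathcal X\times\mathcal Y$ with marginals $(1-\gamma_1)\rho_{\mathcal X}$ and $(1-\gamma_2)\rho_{\mathcal Y}$, and $0\cdot\infty=0$. Then: 1. The minimum is attained. 2. On the set of MDPs with $\rho_\pi>0$ everywhere on $S\times A$ (equivalently, with $\tilde P_\pi$ ergodic), call two MDPs equivalent if there is a bijection $\varphi:S_1\times A_1\to S_2\times A_2$ with $T_1(x,x')=T_2(\varphi(x),\varphi(x'))$ and $(1-\gamma_1)\rho_1(x)=(1-\gamma_2)\rho_2(\varphi(x))$ for all $x,x'$. Then $\mathcal{GW}$ is well defined and a (finite, real-valued) distance on the quotient by this equivalence relation: it is nonnegative, symmetric, satisfies the triangle inequality, and vanishes exactly on pairs of equal classes. 3. On the set of all MDPs as above, $\mathcal{GW}$ is likewise a distance on the quotient by the relation "there is such a bijection $\varphi:\operatorname{supp}\rho_1\to\operatorname{supp}\rho_2$ between the supports of the occupancy measures, with the same two identities for all $x,x'\in\operatorname{supp}\rho_1$". -/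

import Mathlib

open scoped ENNReal NNReal BigOperators

universe u v

/-! ## Finite Markov chains -/

/-- Probability of the path `x 0, …, x n` under the Markov chain with initial distribution `ν` and
transition probabilities `K x x'` (from `x` to `x'`). -/
noncomputable def pathProb {X : Type*} (ν : X → ℝ≥0∞) (K : X → X → ℝ≥0∞) (n : ℕ)
    (x : Fin (n + 1) → X) : ℝ≥0∞ :=
  ν (x 0) * ∏ k : Fin n, K (x k.castSucc) (x k.succ)

/-- Probability of the event `(X_0, …, X_n) ∈ E` for this chain. -/
noncomputable def chainProb {X : Type*} [Fintype X] (ν : X → ℝ≥0∞) (K : X → X → ℝ≥0∞) (n : ℕ)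
    (E : Set (Fin (n + 1) → X)) : ℝ≥0∞ :=
  ∑ x : Fin (n + 1) → X, E.indicator (pathProb ν K n) x

/-- `ℙ(T_ij = t)`: the chain started at `j` avoids `i` before time `t` and is at `i` at time `t`. -/
noncomputable def hitProb {X : Type*} [Fintype X] (K : X → X → ℝ≥0∞) (i j : X) (t : ℕ) : ℝ≥0∞ :=
  chainProb (PMF.pure j) K t {x | (∀ k : Fin t, x k.castSucc ≠ i) ∧ x (Fin.last t) = i}

open Classical in
/-- Mean first-hitting time `𝔼 T_ij ∈ [0, ∞]` of `i` from `j`. The last summand accounts for the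
value `T_ij = ∞` on the event that `i` is never reached. -/
noncomputable def meanHittingTime {X : Type*} [Fintype X] (K : X → X → ℝ≥0∞) (i j : X) : ℝ≥0∞ :=
  if i = j then 0
  else ∑' t : ℕ, (t : ℝ≥0∞) * hitProb K i j t + ∞ * (1 - ∑' t : ℕ, hitProb K i j t)

/-! ## The Gromov-Wasserstein quantity -/

/-- `|a - b|` in `[0, ∞]`. -/
noncomputable def absDiff (a b : ℝ≥0∞) : ℝ≥0∞ := max (a - b) (b - a)

/-- Couplings of two weight functions on finite sets. -/
def couplings {X Y : Type*} [Fintype X] [Fintype Y] (a : X → ℝ≥0∞) (b : Y → ℝ≥0∞) :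
    Set (X × Y → ℝ≥0∞) :=
  {μ | (∀ x, ∑ y, μ (x, y) = a x) ∧ ∀ y, ∑ x, μ (x, y) = b y}

/-- The quantity which is minimized over the couplings (with `0 * ∞ = 0`). -/
noncomputable def gwCost {X Y : Type*} [Fintype X] [Fintype Y] (TX : X → X → ℝ≥0∞)
    (TY : Y → Y → ℝ≥0∞) (μ : X × Y → ℝ≥0∞) : ℝ≥0∞ :=
  (1 / 2) * (∑ p : X × Y, ∑ q : X × Y,
    absDiff (TX p.1 q.1) (TY p.2 q.2) ^ 2 * μ p * μ q) ^ (1 / 2 : ℝ)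

/-- A distance function, in the usual sense. -/
structure IsDistance {Q : Type*} (d : Q → Q → ℝ) : Prop where
  nonneg : ∀ p q, 0 ≤ d p q
  eq_zero_iff : ∀ p q, d p q = 0 ↔ p = q
  symm : ∀ p q, d p q = d q p
  triangle : ∀ p q r, d p r ≤ d p q + d q r

/-! ## Markov decision processes -/

/-- A finite Markov decision process `(S, A, R, P, γ)` with its initial distribution `ρ₀` and a
stationary policy `π`. -/
structure MDP where
  S : Type u
  A : Type v
  fintypeS : Fintype S
  fintypeA : Fintype A
  R : S → A → ℝ
  P : S → A → PMF S
  γ : ℝ≥0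
  γ_lt_one : γ < 1
  ρ₀ : PMF S
  π : S → PMF A

namespace MDP

attribute [instance] MDP.fintypeS MDP.fintypeA

/-- State-action pairs. -/
abbrev SA (M : MDP.{u, v}) : Type (max u v) := M.S × M.A

/-- The initial distribution `ρ₀(s) π(a|s)` on state-action pairs. -/
noncomputable def init (M : MDP.{u, v}) (x : M.SA) : ℝ≥0∞ := M.ρ₀ x.1 * M.π x.1 x.2

/-- The induced transition probability `P_π(x'|x) = P(s'|s,a) π(a'|s')`. -/
noncomputable def trans (M : MDP.{u, v}) (x x' : M.SA) : ℝ≥0∞ :=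
  M.P x.1 x.2 x'.1 * M.π x'.1 x'.2

/-- The occupancy measure `ρ_π(x) = ∑ₜ γᵗ ℙ((sₜ, aₜ) = x)`. -/
noncomputable def occupancy (M : MDP.{u, v}) (x : M.SA) : ℝ≥0∞ :=
  ∑' t : ℕ, (M.γ : ℝ≥0∞) ^ t * chainProb M.init M.trans t {w | w (Fin.last t) = x}

/-- The normalized occupancy measure `(1 - γ) ρ_π`. -/
noncomputable def weight (M : MDP.{u, v}) (x : M.SA) : ℝ≥0∞ :=
  (1 - (M.γ : ℝ≥0∞)) * M.occupancy x

/-- The modified transition probability `(1 - γ) ρ₀(x') + γ P_π(x'|x)`. -/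
noncomputable def modTrans (M : MDP.{u, v}) (x x' : M.SA) : ℝ≥0∞ :=
  (1 - (M.γ : ℝ≥0∞)) * M.init x' + (M.γ : ℝ≥0∞) * M.trans x x'

/-- The first-hitting time `T_π(i, j)` of the process: mean time to reach `i` from `j` in the
modified chain. -/
noncomputable def T (M : MDP.{u, v}) (i j : M.SA) : ℝ≥0∞ := meanHittingTime M.modTrans i j

/-- The Gromov-Wasserstein quantity between two processes. -/
noncomputable def GW (M N : MDP.{u, v}) : ℝ≥0∞ :=
  ⨅ μ ∈ couplings M.weight N.weight, gwCost M.T N.T μ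

/-- The state-action pairs charged by the occupancy measure. -/
def supp (M : MDP.{u, v}) : Set M.SA := {x | 0 < M.occupancy x}

/-- All state-action pairs are charged by the occupancy measure. -/
def FullyOccupied (M : MDP.{u, v}) : Prop := ∀ x : M.SA, 0 < M.occupancy x

/-- Same triple up to a bijection of all state-action pairs. -/
def sameTriple : Setoid MDP.{u, v} where
  r M N := ∃ φ : M.SA ≃ N.SA,
    (∀ x x', M.T x x' = N.T (φ x) (φ x')) ∧ ∀ x, M.weight x = N.weight (φ x)
  iseqv :=
    { refl := fun _ => ⟨Equiv.refl _, fun _ _ => rfl, fun _ => rfl⟩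
      symm := fun ⟨φ, h1, h2⟩ =>
        ⟨φ.symm, fun x x' => by simp [h1], fun x => by simp [h2]⟩
      trans := fun ⟨φ, h1, h2⟩ ⟨ψ, h3, h4⟩ =>
        ⟨φ.trans ψ, fun x x' => by simp [h1, h3], fun x => by simp [h2, h4]⟩ }

/-- Same triple up to a bijection of the state-action pairs charged by the occupancy measure. -/
def sameTripleOnSupp : Setoid MDP.{u, v} where
  r M N := ∃ φ : M.supp ≃ N.supp,
    (∀ x x' : M.supp, M.T x x' = N.T (φ x) (φ x')) ∧ ∀ x : M.supp, M.weight x = N.weight (φ x)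
  iseqv :=
    { refl := fun _ => ⟨Equiv.refl _, fun _ _ => rfl, fun _ => rfl⟩
      symm := fun ⟨φ, h1, h2⟩ =>
        ⟨φ.symm, fun x x' => by simp [h1], fun x => by simp [h2]⟩
      trans := fun ⟨φ, h1, h2⟩ ⟨ψ, h3, h4⟩ =>
        ⟨φ.trans ψ, fun x x' => by simp [h1, h3], fun x => by simp [h2, h4]⟩ }

/-- The relation `sameTriple` on the processes all of whose state-action pairs are charged. -/
def sameTripleFull : Setoid {M : MDP.{u, v} // M.FullyOccupied} :=
  sameTriple.comap Subtype.val

end MDP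

/-! ## The absolute difference on `[0, ∞]` -/

/-! The point special to MDPs is that `T i j` is finite whenever `i` is charged by the occupancy
measure (`MDP.T_ne_top`): from any state the modified chain restarts with probability `1 - γ` and
then reaches `i` at a fixed time with a positive probability independent of the state, so survival
without hitting `i` decays geometrically. An infinite discrepancy therefore only meets pairs of zero
mass, which makes the cost finite and continuous on the compact set of couplings
(`continuousOn_gwCost`), and the minimum is attained.

The rest is the usual Gromov-Wasserstein argument. Gluing two optimal couplings and Minkowski's
inequality give the triangle inequality (`exists_gwCost_le_add`). Since `T i j = 0` only for `i =
j`, a coupling of cost zero is carried by the graph of a bijection between supports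
(`exists_equiv_of_gwCost_eq_zero`). On fully occupied processes the supports are everything, so the
second quotient is a special case of the third. -/

theorem absDiff_comm (a b : ℝ≥0∞) : absDiff a b = absDiff b a := max_comm _ _

theorem absDiff_eq_zero_iff {a b : ℝ≥0∞} : absDiff a b = 0 ↔ a = b := by
  simp only [absDiff, ← nonpos_iff_eq_zero, max_le_iff, tsub_le_iff_right, zero_add]
  exact ⟨fun h => le_antisymm h.1 h.2, fun h => ⟨h.le, h.ge⟩⟩

theorem absDiff_triangle (a b c : ℝ≥0∞) : absDiff a c ≤ absDiff a b + absDiff b c := by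
  refine max_le ?_ ?_
  · exact tsub_le_tsub_add_tsub.trans (add_le_add (le_max_left _ _) (le_max_left _ _))
  · refine (tsub_le_tsub_add_tsub (b := b)).trans ?_
    rw [add_comm]
    exact add_le_add (le_max_right _ _) (le_max_right _ _)

theorem absDiff_ne_top {a b : ℝ≥0∞} (ha : a ≠ ∞) (hb : b ≠ ∞) : absDiff a b ≠ ∞ := by
  have h : absDiff a b ≤ max a b := max_le_max tsub_le_self tsub_le_self
  exact ne_top_of_le_ne_top (by simp [ha, hb]) h

/-! ## Couplings -/

section Couplings

variable {X Y Z : Type*} [Fintype X] [Fintype Y] [Fintype Z]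
  {a : X → ℝ≥0∞} {b : Y → ℝ≥0∞} {c : Z → ℝ≥0∞}

theorem le_left_of_mem_couplings {μ : X × Y → ℝ≥0∞} (h : μ ∈ couplings a b) (p : X × Y) :
    μ p ≤ a p.1 := by
  rw [← h.1 p.1]
  exact Finset.single_le_sum (f := fun y => μ (p.1, y)) (fun _ _ => zero_le) (Finset.mem_univ p.2)

theorem le_right_of_mem_couplings {μ : X × Y → ℝ≥0∞} (h : μ ∈ couplings a b) (p : X × Y) :
    μ p ≤ b p.2 := by
  rw [← h.2 p.2]
  exact Finset.single_le_sum (f := fun x => μ (x, p.2)) (fun _ _ => zero_le) (Finset.mem_univ p.1)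

theorem ne_top_of_sum_eq_one (ha : ∑ x, a x = 1) (x : X) : a x ≠ ∞ := by
  have : a x ≤ 1 := ha ▸ Finset.single_le_sum (fun _ _ => zero_le) (Finset.mem_univ x)
  exact ne_top_of_le_ne_top ENNReal.one_ne_top this

theorem prod_mem_couplings (ha : ∑ x, a x = 1) (hb : ∑ y, b y = 1) :
    (fun p : X × Y => a p.1 * b p.2) ∈ couplings a b := by
  refine ⟨fun x => ?_, fun y => ?_⟩
  · simp [← Finset.mul_sum, hb]
  · simp [← Finset.sum_mul, ha]

theorem swap_mem_couplings {μ : X × Y → ℝ≥0∞} (h : μ ∈ couplings a b) :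
    (fun p : Y × X => μ p.swap) ∈ couplings b a :=
  ⟨h.2, h.1⟩

/-- The marginal conditions are closed, and a power of `[0, ∞]` is compact. -/
theorem isCompact_couplings (a : X → ℝ≥0∞) (b : Y → ℝ≥0∞) : IsCompact (couplings a b) := by
  apply IsClosed.isCompact
  simp only [couplings, Set.ofPred_and, Set.ofPred_forall]
  refine IsClosed.inter ?_ ?_ <;> refine isClosed_iInter fun _ => isClosed_eq ?_ continuous_const
  all_goals exact continuous_finsetSum _ fun _ _ => continuous_apply _

end Couplings

/-! ## The Gromov-Wasserstein cost -/

section GW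

variable {X Y Z : Type*} [Fintype X] [Fintype Y] [Fintype Z]
  {a : X → ℝ≥0∞} {b : Y → ℝ≥0∞} {c : Z → ℝ≥0∞}
  {TX : X → X → ℝ≥0∞} {TY : Y → Y → ℝ≥0∞} {TZ : Z → Z → ℝ≥0∞}

/-- An infinite difference needs an infinite hitting time, so `p.1` or `p.2` has zero marginal mass,
and this mass bounds `μ p`. -/
theorem eq_zero_of_absDiff_eq_top (hTX : ∀ x x', a x ≠ 0 → TX x x' ≠ ∞)
    (hTY : ∀ y y', b y ≠ 0 → TY y y' ≠ ∞) {p q : X × Y}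
    (h : absDiff (TX p.1 q.1) (TY p.2 q.2) = ∞) {μ : X × Y → ℝ≥0∞} (hμ : μ ∈ couplings a b) :
    μ p = 0 := by
  by_contra h0
  refine absDiff_ne_top (hTX _ _ fun h1 => h0 ?_) (hTY _ _ fun h1 => h0 ?_) h
  · exact nonpos_iff_eq_zero.1 (h1 ▸ le_left_of_mem_couplings hμ p)
  · exact nonpos_iff_eq_zero.1 (h1 ▸ le_right_of_mem_couplings hμ p)

/-- Multiplication on `[0, ∞]` is discontinuous at `(0, ∞)`. Terms with an infinite coefficient
vanish identically on couplings; in the others all factors are finite. -/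
theorem continuousOn_gwCost (ha : ∑ x, a x = 1)
    (hTX : ∀ x x', a x ≠ 0 → TX x x' ≠ ∞) (hTY : ∀ y y', b y ≠ 0 → TY y y' ≠ ∞) :
    ContinuousOn (gwCost TX TY) (couplings a b) := by
  have hfin : ∀ μ ∈ couplings a b, ∀ p, μ p ≠ ∞ := fun μ hμ p =>
    ne_top_of_le_ne_top (ne_top_of_sum_eq_one ha _) (le_left_of_mem_couplings hμ p)
  have key : ContinuousOn (fun μ : X × Y → ℝ≥0∞ => ∑ p : X × Y, ∑ q : X × Y,
      absDiff (TX p.1 q.1) (TY p.2 q.2) ^ 2 * μ p * μ q) (couplings a b) := by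
    refine continuousOn_finsetSum _ fun p _ => continuousOn_finsetSum _ fun q _ => ?_
    by_cases h : absDiff (TX p.1 q.1) (TY p.2 q.2) = ∞
    · refine (continuousOn_const (c := 0)).congr fun μ hμ => ?_
      simp [eq_zero_of_absDiff_eq_top hTX hTY h hμ]
    · have h2 : absDiff (TX p.1 q.1) (TY p.2 q.2) ^ 2 ≠ ∞ := ENNReal.pow_ne_top h
      intro μ hμ
      refine Filter.Tendsto.mono_left ?_ nhdsWithin_le_nhds
      refine ENNReal.Tendsto.mul (ENNReal.Tendsto.const_mul (continuous_apply p).continuousAt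
        (Or.inr h2)) (Or.inr (hfin μ hμ q)) (continuous_apply q).continuousAt
        (Or.inr (ENNReal.mul_ne_top h2 (hfin μ hμ p)))
  have h3 : Continuous fun t : ℝ≥0∞ => (1 / 2 : ℝ≥0∞) * t ^ (1 / 2 : ℝ) :=
    (ENNReal.continuous_const_mul (by simp)).comp (ENNReal.continuous_rpow_const)
  exact h3.comp_continuousOn key

theorem exists_gwCost_eq_iInf (ha : ∑ x, a x = 1) (hb : ∑ y, b y = 1)
    (hTX : ∀ x x', a x ≠ 0 → TX x x' ≠ ∞) (hTY : ∀ y y', b y ≠ 0 → TY y y' ≠ ∞) :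
    ∃ μ ∈ couplings a b, gwCost TX TY μ = ⨅ μ ∈ couplings a b, gwCost TX TY μ := by
  obtain ⟨μ, hμ, hmin⟩ := (isCompact_couplings a b).exists_isMinOn
    ⟨_, prod_mem_couplings ha hb⟩ (continuousOn_gwCost ha hTX hTY)
  exact ⟨μ, hμ, le_antisymm (le_iInf₂ fun ν hν => hmin hν) (iInf₂_le μ hμ)⟩

theorem gwCost_ne_top (ha : ∑ x, a x = 1) (hTX : ∀ x x', a x ≠ 0 → TX x x' ≠ ∞)
    (hTY : ∀ y y', b y ≠ 0 → TY y y' ≠ ∞) {μ : X × Y → ℝ≥0∞} (hμ : μ ∈ couplings a b) :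
    gwCost TX TY μ ≠ ∞ := by
  have hfin : ∀ p, μ p ≠ ∞ := fun p =>
    ne_top_of_le_ne_top (ne_top_of_sum_eq_one ha _) (le_left_of_mem_couplings hμ p)
  refine ENNReal.mul_ne_top (by simp) (ENNReal.rpow_ne_top_of_nonneg (by norm_num) ?_)
  refine ENNReal.sum_ne_top.2 fun p _ => ENNReal.sum_ne_top.2 fun q _ => ?_
  by_cases h : absDiff (TX p.1 q.1) (TY p.2 q.2) = ∞
  · simp [eq_zero_of_absDiff_eq_top hTX hTY h hμ]
  · exact ENNReal.mul_ne_top (ENNReal.mul_ne_top (ENNReal.pow_ne_top h) (hfin p)) (hfin q)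

theorem gwCost_swap (TX : X → X → ℝ≥0∞) (TY : Y → Y → ℝ≥0∞) (μ : X × Y → ℝ≥0∞) :
    gwCost TY TX (fun p => μ p.swap) = gwCost TX TY μ := by
  unfold gwCost
  congr 2
  refine Fintype.sum_equiv (Equiv.prodComm Y X) _ _ fun p =>
    Fintype.sum_equiv (Equiv.prodComm Y X) _ _ fun q => ?_
  simp [absDiff_comm]

theorem gwCost_eq_zero_iff {μ : X × Y → ℝ≥0∞} : gwCost TX TY μ = 0 ↔
    ∀ p q, μ p ≠ 0 → μ q ≠ 0 → TX p.1 q.1 = TY p.2 q.2 := by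
  simp only [gwCost, mul_eq_zero, ENNReal.rpow_eq_zero_iff, Finset.sum_eq_zero_iff,
    Finset.mem_univ, true_implies, pow_eq_zero_iff two_ne_zero, absDiff_eq_zero_iff]
  norm_num
  grind

/-- Minkowski's inequality with exponent `2` for weighted sums. -/
theorem rpow_half_sum_add_sq_mul_le {ι : Type*} (s : Finset ι) (f g w : ι → ℝ≥0∞) :
    (∑ i ∈ s, (f i + g i) ^ 2 * w i) ^ (1 / 2 : ℝ) ≤
      (∑ i ∈ s, f i ^ 2 * w i) ^ (1 / 2 : ℝ) + (∑ i ∈ s, g i ^ 2 * w i) ^ (1 / 2 : ℝ) := by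
  have h := ENNReal.Lp_add_le s (fun i => f i * w i ^ (1 / 2 : ℝ))
    (fun i => g i * w i ^ (1 / 2 : ℝ)) (p := 2) (by norm_num)
  have e : ∀ x y : ℝ≥0∞, (x * y ^ (1 / 2 : ℝ)) ^ (2 : ℝ) = x ^ 2 * y := fun x y => by
    rw [ENNReal.mul_rpow_of_nonneg _ _ (by norm_num), ← ENNReal.rpow_mul]
    norm_num
  simpa only [← add_mul, e] using h

/-- Change of variables in a double weighted sum. -/
theorem sum_sum_mul_mul_eq_of_map {W P : Type*} [Fintype W] [Fintype P] {τ : W → ℝ≥0∞}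
    {μ : P → ℝ≥0∞} {f : W → P} (h : ∀ G : P → ℝ≥0∞, ∑ p, G p * μ p = ∑ w, G (f w) * τ w)
    (F : P → P → ℝ≥0∞) :
    ∑ p, ∑ q, F p q * μ p * μ q = ∑ w : W × W, F (f w.1) (f w.2) * (τ w.1 * τ w.2) := by
  rw [Fintype.sum_prod_type]
  calc ∑ p, ∑ q, F p q * μ p * μ q
      = ∑ p, (∑ q, F p q * μ q) * μ p := by
        simp only [Finset.sum_mul]
        exact Finset.sum_congr rfl fun p _ => Finset.sum_congr rfl fun q _ => by ring
    _ = ∑ w, (∑ q, F (f w) q * μ q) * τ w := h fun p => ∑ q, F p q * μ q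
    _ = _ := by
        refine Finset.sum_congr rfl fun w _ => ?_
        rw [h fun q => F (f w) q, Finset.sum_mul]
        exact Finset.sum_congr rfl fun q _ => by ring

/-- The gluing of two couplings along their common marginal. -/
noncomputable def glue (b : Y → ℝ≥0∞) (μ : X × Y → ℝ≥0∞) (ν : Y × Z → ℝ≥0∞)
    (w : X × Y × Z) : ℝ≥0∞ :=
  μ (w.1, w.2.1) * ν w.2 / b w.2.1

/-- Where `b y = 0`, the coupling `μ` also vanishes, so the division by zero is harmless. -/
theorem sum_glue_right {μ : X × Y → ℝ≥0∞} {ν : Y × Z → ℝ≥0∞} (hb : ∀ y, b y ≠ ∞)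
    (hμ : μ ∈ couplings a b) (hν : ν ∈ couplings b c) (x : X) (y : Y) :
    ∑ z, glue b μ ν (x, y, z) = μ (x, y) := by
  simp only [glue, div_eq_mul_inv, ← Finset.sum_mul, ← Finset.mul_sum, hν.1]
  by_cases h : b y = 0
  · have := le_right_of_mem_couplings hμ (x, y)
    simp_all
  · rw [mul_assoc, ENNReal.mul_inv_cancel h (hb y), mul_one]

theorem sum_glue_left {μ : X × Y → ℝ≥0∞} {ν : Y × Z → ℝ≥0∞} (hb : ∀ y, b y ≠ ∞)
    (hμ : μ ∈ couplings a b) (hν : ν ∈ couplings b c) (y : Y) (z : Z) :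
    ∑ x, glue b μ ν (x, y, z) = ν (y, z) := by
  simp only [glue, div_eq_mul_inv, ← Finset.sum_mul, hμ.2]
  by_cases h : b y = 0
  · have := le_left_of_mem_couplings hν (y, z)
    simp_all
  · rw [mul_right_comm, ENNReal.mul_inv_cancel h (hb y), one_mul]

/-- All three couplings are images of the glued weight `τ`, so the three costs become `L²` norms for
the same weight `τ ⊗ τ`, where Minkowski applies. -/
theorem exists_gwCost_le_add {μ : X × Y → ℝ≥0∞} {ν : Y × Z → ℝ≥0∞} (hb : ∀ y, b y ≠ ∞)
    (hμ : μ ∈ couplings a b) (hν : ν ∈ couplings b c) :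
    ∃ σ ∈ couplings a c, gwCost TX TZ σ ≤ gwCost TX TY μ + gwCost TY TZ ν := by
  set τ := glue b μ ν with hτ
  set σ : X × Z → ℝ≥0∞ := fun p => ∑ y, τ (p.1, y, p.2) with hσ
  have m1 : ∀ G : X × Y → ℝ≥0∞, ∑ p, G p * μ p = ∑ w, G (w.1, w.2.1) * τ w := fun G => by
    simp only [Fintype.sum_prod_type, ← Finset.mul_sum]
    simp only [hτ, sum_glue_right hb hμ hν]
  have m2 : ∀ G : Y × Z → ℝ≥0∞, ∑ p, G p * ν p = ∑ w, G w.2 * τ w := fun G => by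
    rw [Fintype.sum_prod_type_right (f := fun w => G w.2 * τ w)]
    simp only [← Finset.mul_sum]
    simp only [hτ, sum_glue_left hb hμ hν]
  have m3 : ∀ G : X × Z → ℝ≥0∞, ∑ p, G p * σ p = ∑ w, G (w.1, w.2.2) * τ w := fun G => by
    simp only [Fintype.sum_prod_type, hσ, Finset.mul_sum]
    exact Finset.sum_congr rfl fun x _ => Finset.sum_comm
  refine ⟨σ, ⟨fun x => ?_, fun z => ?_⟩, ?_⟩
  · simp only [hσ]
    rw [Finset.sum_comm]
    simp only [hτ, sum_glue_right hb hμ hν]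
    exact hμ.1 x
  · simp only [hσ]
    rw [Finset.sum_comm]
    simp only [hτ, sum_glue_left hb hμ hν]
    exact hν.2 z
  · unfold gwCost
    rw [sum_sum_mul_mul_eq_of_map m1 fun p q => absDiff (TX p.1 q.1) (TY p.2 q.2) ^ 2,
      sum_sum_mul_mul_eq_of_map m2 fun p q => absDiff (TY p.1 q.1) (TZ p.2 q.2) ^ 2,
      sum_sum_mul_mul_eq_of_map m3 fun p q => absDiff (TX p.1 q.1) (TZ p.2 q.2) ^ 2, ← mul_add]
    gcongr
    refine le_trans ?_ (rpow_half_sum_add_sq_mul_le _ _ _ _)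
    gcongr
    exact absDiff_triangle _ _ _

/-- A coupling of cost zero is carried by the graph of a bijection between the supports. -/
theorem exists_equiv_of_gwCost_eq_zero (hTX : ∀ x x', TX x x' = 0 ↔ x = x')
    (hTY : ∀ y y', TY y y' = 0 ↔ y = y') {A : Set X} {B : Set Y} (hA : ∀ x, x ∈ A ↔ a x ≠ 0)
    (hB : ∀ y, y ∈ B ↔ b y ≠ 0) {μ : X × Y → ℝ≥0∞} (hμ : μ ∈ couplings a b)
    (h : gwCost TX TY μ = 0) :
    ∃ φ : A ≃ B, (∀ x x' : A, TX x x' = TY (φ x) (φ x')) ∧ ∀ x : A, a x = b (φ x) := by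
  rw [gwCost_eq_zero_iff] at h
  -- Two charged pairs over the same `x` give `TY y y' = TX x x = 0`.
  have right_unique : ∀ {x y y'}, μ (x, y) ≠ 0 → μ (x, y') ≠ 0 → y = y' := fun h1 h2 =>
    (hTY _ _).1 ((h _ _ h1 h2).symm.trans ((hTX _ _).2 rfl))
  have left_unique : ∀ {x x' y}, μ (x, y) ≠ 0 → μ (x', y) ≠ 0 → x = x' := fun h1 h2 =>
    (hTX _ _).1 ((h _ _ h1 h2).trans ((hTY _ _).2 rfl))
  have exr : ∀ x : A, ∃ y : B, μ (x, y) ≠ 0 := fun x => by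
    have h1 := (hA x).1 x.2
    rw [← hμ.1] at h1
    obtain ⟨y, -, hy⟩ := Finset.exists_ne_zero_of_sum_ne_zero h1
    exact ⟨⟨y, (hB y).2 fun h0 => hy (by simpa [h0] using le_right_of_mem_couplings hμ (x.1, y))⟩,
      hy⟩
  have exl : ∀ y : B, ∃ x : A, μ (x, y) ≠ 0 := fun y => by
    have h1 := (hB y).1 y.2
    rw [← hμ.2] at h1
    obtain ⟨x, -, hx⟩ := Finset.exists_ne_zero_of_sum_ne_zero h1
    exact ⟨⟨x, (hA x).2 fun h0 => hx (by simpa [h0] using le_left_of_mem_couplings hμ (x, y.1))⟩,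
      hx⟩
  choose f hf using exr
  choose g hg using exl
  refine ⟨⟨f, g, fun x => Subtype.ext (left_unique (hg _) (hf _)),
    fun y => Subtype.ext (right_unique (hf _) (hg _))⟩, fun x x' => h _ _ (hf x) (hf x'),
    fun x => ?_⟩
  change a x = b (f x)
  -- Both marginals reduce to the single mass `μ (x, f x)`.
  rw [← hμ.1, ← hμ.2, Finset.sum_eq_single (f x : Y), Finset.sum_eq_single (x : X)]
  · intro x' _ hx'
    by_contra h0
    exact hx' (left_unique h0 (hf x))
  · simp
  · intro y' _ hy'
    by_contra h0
    exact hy' (right_unique h0 (hf x))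
  · simp

open Classical in
-- The witness puts mass `a x` on each point `(x, φ x)` of the graph.
theorem exists_gwCost_eq_zero_of_equiv {A : Set X} {B : Set Y} (hA : ∀ x, x ∈ A ↔ a x ≠ 0)
    (hB : ∀ y, y ∈ B ↔ b y ≠ 0) (φ : A ≃ B) (hT : ∀ x x' : A, TX x x' = TY (φ x) (φ x'))
    (hφ : ∀ x : A, a x = b (φ x)) : ∃ μ ∈ couplings a b, gwCost TX TY μ = 0 := by
  refine ⟨fun p => if ∃ x : A, x = p.1 ∧ φ x = p.2 then a p.1 else 0,
    ⟨fun x => ?_, fun y => ?_⟩, gwCost_eq_zero_iff.2 fun p q hp hq => ?_⟩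
  · by_cases hx : x ∈ A
    · rw [Finset.sum_eq_single (φ ⟨x, hx⟩ : Y)]
      · exact if_pos ⟨⟨x, hx⟩, rfl, rfl⟩
      · rintro y - hy
        refine if_neg ?_
        rintro ⟨x', rfl, rfl⟩
        exact hy rfl
      · simp
    · have : a x = 0 := not_not.1 fun h => hx ((hA x).2 h)
      simp [this]
  · by_cases hy : y ∈ B
    · rw [Finset.sum_eq_single (φ.symm ⟨y, hy⟩ : X)]
      · refine (if_pos ⟨φ.symm ⟨y, hy⟩, rfl, by simp⟩).trans ((hφ _).trans ?_)
        simp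
      · rintro x - hx
        refine if_neg ?_
        rintro ⟨x', rfl, rfl⟩
        simp at hx
      · simp
    · have : b y = 0 := not_not.1 fun h => hy ((hB y).2 h)
      rw [this]
      refine Finset.sum_eq_zero fun x _ => if_neg ?_
      rintro ⟨x', rfl, rfl⟩
      exact hy (φ x').2
  · obtain ⟨x, h1, h2⟩ := not_not.1 fun h => hp (if_neg h)
    obtain ⟨x', h1', h2'⟩ := not_not.1 fun h => hq (if_neg h)
    rw [← h1, ← h2, ← h1', ← h2', hT]

end GW

/-! ## Expectations along a finite Markov chain -/

section Chain

variable {X : Type*} [Fintype X]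

/-- The one-step expectation `f ↦ ∑ y, K x y f y` of a transition kernel. -/
noncomputable def kernelStep (K : X → X → ℝ≥0∞) (f : X → ℝ≥0∞) (x : X) : ℝ≥0∞ :=
  ∑ y, K x y * f y

theorem kernelStep_add (K : X → X → ℝ≥0∞) (f g : X → ℝ≥0∞) (x : X) :
    kernelStep K (fun y => f y + g y) x = kernelStep K f x + kernelStep K g x := by
  simp [kernelStep, mul_add, Finset.sum_add_distrib]

theorem iterate_kernelStep_add (K : X → X → ℝ≥0∞) (f g : X → ℝ≥0∞) (n : ℕ) (x : X) :
    (kernelStep K)^[n] (fun y => f y + g y) x =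
      (kernelStep K)^[n] f x + (kernelStep K)^[n] g x := by
  induction n generalizing f g with
  | zero => rfl
  | succ n ih =>
    simp only [Function.iterate_succ_apply, ← ih]
    rw [show kernelStep K (fun y => f y + g y) = _ from funext (kernelStep_add K f g)]

theorem kernelStep_const_mul (K : X → X → ℝ≥0∞) (r : ℝ≥0∞) (f : X → ℝ≥0∞) (x : X) :
    kernelStep K (fun y => r * f y) x = r * kernelStep K f x := by
  simp only [kernelStep, Finset.mul_sum]
  exact Finset.sum_congr rfl fun y _ => by ring

theorem kernelStep_mono {K K' : X → X → ℝ≥0∞} {f g : X → ℝ≥0∞} (hK : ∀ x y, K x y ≤ K' x y)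
    (h : ∀ x, f x ≤ g x) (x : X) : kernelStep K f x ≤ kernelStep K' g x :=
  Finset.sum_le_sum fun y _ => mul_le_mul' (hK x y) (h y)

theorem kernelStep_one {K : X → X → ℝ≥0∞} (hK : ∀ x, ∑ y, K x y = 1) :
    kernelStep K (fun _ => 1) = fun _ => 1 := by
  ext x
  simp [kernelStep, hK]

/-- The expectation of `g (X_n)`, as a sum over paths, is computed by iterating the kernel. -/
theorem sum_pathProb_mul (ν : X → ℝ≥0∞) (K : X → X → ℝ≥0∞) (g : X → ℝ≥0∞) (n : ℕ) :
    ∑ w : Fin (n + 1) → X, pathProb ν K n w * g (w (Fin.last n)) =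
      ∑ x, ν x * (kernelStep K)^[n] g x := by
  induction n generalizing g with
  | zero =>
    rw [← (Equiv.funUnique (Fin 1) X).symm.sum_comp]
    simp [pathProb]
  | succ n ih =>
    -- Summing out the last state of the path first replaces `g` by `kernelStep K g`.
    rw [Function.iterate_succ_apply, ← ih, ← (Fin.snocEquiv fun _ => X).sum_comp,
      Fintype.sum_prod_type_right]
    refine Finset.sum_congr rfl fun w _ => ?_
    rw [kernelStep, Finset.mul_sum]
    refine Finset.sum_congr rfl fun y _ => ?_
    have h0 : (Fin.snocEquiv fun _ => X) (y, w) 0 = w 0 := by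
      exact Fin.snoc_castSucc (α := fun _ => X) y w 0
    simp only [pathProb, Fin.prod_univ_castSucc, h0]
    simp only [Fin.snocEquiv, Equiv.coe_fn_mk, Fin.succ_last, Fin.snoc_last, Fin.snoc_castSucc,
      Fin.succ_castSucc]
    ring

/-- The point mass at `i`, as a function. -/
noncomputable def pointMass (i : X) : X → ℝ≥0∞ := Set.indicator {i} 1

theorem chainProb_last (ν : X → ℝ≥0∞) (K : X → X → ℝ≥0∞) (n : ℕ) (i : X) :
    chainProb ν K n {w | w (Fin.last n) = i} = ∑ x, ν x * (kernelStep K)^[n] (pointMass i) x := by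
  rw [← sum_pathProb_mul, chainProb]
  refine Finset.sum_congr rfl fun w _ => ?_
  by_cases h : w (Fin.last n) = i <;> simp [pointMass, h]

/-! ### Killed chain and first-hitting probabilities -/

open Classical in
/-- The kernel killed at `i`. -/
noncomputable def killed (K : X → X → ℝ≥0∞) (i : X) (x y : X) : ℝ≥0∞ :=
  if x = i then 0 else K x y

theorem kernelStep_killed_self (K : X → X → ℝ≥0∞) (i : X) (f : X → ℝ≥0∞) :
    kernelStep (killed K i) f i = 0 := by
  simp [kernelStep, killed]

theorem kernelStep_killed_of_ne (K : X → X → ℝ≥0∞) {i x : X} (h : x ≠ i) (f : X → ℝ≥0∞) :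
    kernelStep (killed K i) f x = kernelStep K f x := by
  simp [kernelStep, killed, h]

/-- The killed chain can enter `i` but not leave it, so a path visiting `i` before its end has
killed weight zero. -/
theorem hitProb_eq (K : X → X → ℝ≥0∞) (i j : X) (t : ℕ) :
    hitProb K i j t = (kernelStep (killed K i))^[t] (pointMass i) j := by
  classical
  have h := sum_pathProb_mul (PMF.pure j) (killed K i) (pointMass i) t
  simp only [PMF.pure_apply, ite_mul, one_mul, zero_mul, Finset.sum_ite_eq', Finset.mem_univ,
    if_true] at h
  rw [← h, hitProb, chainProb]
  refine Finset.sum_congr rfl fun w _ => ?_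
  by_cases h1 : w (Fin.last t) = i
  · by_cases h2 : ∀ k : Fin t, w k.castSucc ≠ i
    · refine (Set.indicator_of_mem (by exact ⟨h2, h1⟩) _).trans ?_
      simp [pathProb, killed, h2, pointMass, h1]
    · rw [Set.indicator_of_notMem fun hw => h2 hw.1]
      push Not at h2
      obtain ⟨k, hk⟩ := h2
      have : ∏ k : Fin t, killed K i (w k.castSucc) (w k.succ) = 0 :=
        Finset.prod_eq_zero (Finset.mem_univ k) (by simp [killed, hk])
      simp [pathProb, this]
  · rw [Set.indicator_of_notMem fun hw => h1 hw.2]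
    simp [pointMass, h1]

variable {K : X → X → ℝ≥0∞} {i : X}

theorem pointMass_add_kernelStep_killed_one (hK : ∀ x, ∑ y, K x y = 1) (x : X) :
    pointMass i x + kernelStep (killed K i) (fun _ => 1) x = 1 := by
  by_cases h : x = i
  · subst h
    simp [kernelStep_killed_self, pointMass]
  · simp [kernelStep_killed_of_ne K h, kernelStep_one hK, pointMass, h]

/-- Either `i` is hit before time `n` or the killed chain survives `n` steps. -/
theorem sum_hitProb_add_survival (hK : ∀ x, ∑ y, K x y = 1) (n : ℕ) (j : X) :
    ∑ t ∈ Finset.range n, hitProb K i j t + (kernelStep (killed K i))^[n] (fun _ => 1) j = 1 := by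
  induction n generalizing j with
  | zero => simp
  | succ n ih =>
    -- Surviving `n` steps splits into hitting `i` at time `n` and surviving one more step.
    have e : (fun x => pointMass i x + kernelStep (killed K i) (fun _ => 1) x) = fun _ => 1 :=
      funext (pointMass_add_kernelStep_killed_one hK)
    rw [Finset.sum_range_succ, add_assoc, hitProb_eq, Function.iterate_succ_apply]
    rw [← iterate_kernelStep_add, e]
    exact ih j

/-- Being at `i` at time `n` excludes surviving `n + 1` steps of the killed chain. -/
theorem iterate_pointMass_add_survival_le (hK : ∀ x, ∑ y, K x y = 1) (n : ℕ) (j : X) :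
    (kernelStep K)^[n] (pointMass i) j + (kernelStep (killed K i))^[n + 1] (fun _ => 1) j ≤ 1 := by
  induction n generalizing j with
  | zero => exact (pointMass_add_kernelStep_killed_one hK j).le
  | succ n ih =>
    rw [Function.iterate_succ_apply', Function.iterate_succ_apply' _ (n + 1)]
    -- From `i` the survival term vanishes; elsewhere the first steps of both chains agree.
    by_cases h : j = i
    · subst h
      rw [kernelStep_killed_self, add_zero]
      exact (kernelStep_mono (fun _ _ => le_rfl) (fun x => le_self_add.trans (ih x)) j).trans_eq
        (congrFun (kernelStep_one hK) j)
    · rw [kernelStep_killed_of_ne K h, ← kernelStep_add]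
      exact (kernelStep_mono (fun _ _ => le_rfl) ih j).trans_eq (congrFun (kernelStep_one hK) j)

/-! ### Geometric decay of survival and finite mean hitting times -/

theorem survival_le_one (hK : ∀ x, ∑ y, K x y = 1) (n : ℕ) (j : X) :
    (kernelStep (killed K i))^[n] (fun _ => 1) j ≤ 1 :=
  le_add_self.trans (sum_hitProb_add_survival hK n j).le

/-- Markov property: after surviving `n` steps, the next `m` are survived with probability at most
`r`. -/
theorem survival_add_le {m : ℕ} {r : ℝ≥0∞}
    (h : ∀ x, (kernelStep (killed K i))^[m] (fun _ => 1) x ≤ r) (n : ℕ) (j : X) :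
    (kernelStep (killed K i))^[n + m] (fun _ => 1) j ≤
      r * (kernelStep (killed K i))^[n] (fun _ => 1) j := by
  induction n generalizing j with
  | zero => simpa using h j
  | succ n ih =>
    rw [Nat.succ_add, Function.iterate_succ_apply', Function.iterate_succ_apply',
      ← kernelStep_const_mul]
    exact kernelStep_mono (fun _ _ => le_rfl) ih j

/-- Partial sums satisfy `S ≤ m + r * S`, hence `S ≤ m / (1 - r)`; subtraction is legitimate because
they are finite. -/
theorem tsum_ne_top_of_contract {u : ℕ → ℝ≥0∞} {m : ℕ} {r : ℝ≥0∞} (hr : r < 1)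
    (hu : ∀ n, u n ≤ 1) (h : ∀ n, u (n + m) ≤ r * u n) : ∑' n, u n ≠ ∞ := by
  have hr' : 1 - r ≠ 0 := (tsub_pos_of_lt hr).ne'
  refine ne_top_of_le_ne_top (b := m / (1 - r))
    (ENNReal.div_ne_top (ENNReal.natCast_ne_top m) hr') ?_
  rw [ENNReal.tsum_eq_iSup_nat]
  refine iSup_le fun N => ?_
  have hfin : ∑ n ∈ Finset.range N, u n ≠ ∞ :=
    ENNReal.sum_ne_top.2 fun n _ => ne_top_of_le_ne_top ENNReal.one_ne_top (hu n)
  have hle : ∑ n ∈ Finset.range N, u n ≤ m + r * ∑ n ∈ Finset.range N, u n := by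
    calc ∑ n ∈ Finset.range N, u n ≤ ∑ n ∈ Finset.range (m + N), u n :=
          Finset.sum_le_sum_of_subset (Finset.range_mono (Nat.le_add_left _ _))
      _ = ∑ n ∈ Finset.range m, u n + ∑ n ∈ Finset.range N, u (m + n) :=
          Finset.sum_range_add _ _ _
      _ ≤ ∑ n ∈ Finset.range m, 1 + ∑ n ∈ Finset.range N, r * u n := by
          gcongr with n _ n _
          · exact hu n
          · rw [add_comm]
            exact h n
      _ = _ := by simp [Finset.mul_sum]
  rw [ENNReal.le_div_iff_mul_le (Or.inl hr') (Or.inl (by simp)), ENNReal.mul_sub (by simp [hfin]),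
    mul_one, mul_comm, tsub_le_iff_right]
  exact hle

theorem sum_range_add_tsum_nat_add (f : ℕ → ℝ≥0∞) (n : ℕ) :
    ∑ t ∈ Finset.range n, f t + ∑' k, f (k + n) = ∑' t, f t :=
  (ENNReal.summable (f := fun k => f (k + n))).sum_add_tsum_nat_add'

/-- Tail-sum formula for an expectation, from `t = ∑ n < t, 1` and an exchange of sums. -/
theorem tsum_natCast_mul (f : ℕ → ℝ≥0∞) :
    ∑' t : ℕ, (t : ℝ≥0∞) * f t = ∑' n : ℕ, ∑' k : ℕ, f (k + (n + 1)) := by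
  have h1 : ∀ t : ℕ, (t : ℝ≥0∞) * f t = ∑' n : ℕ, if n < t then f t else 0 := fun t => by
    rw [tsum_eq_sum (s := Finset.range t) fun n hn => if_neg (by simpa using hn),
      Finset.sum_congr rfl fun n hn => if_pos (by simpa using hn)]
    simp
  simp_rw [h1]
  rw [ENNReal.tsum_comm]
  refine tsum_congr fun n => ?_
  rw [← sum_range_add_tsum_nat_add (fun t => if n < t then f t else 0) (n + 1),
    Finset.sum_eq_zero, zero_add]
  · exact tsum_congr fun k => if_pos (by omega)
  · intro t ht
    exact if_neg (by simp at ht; omega)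

theorem sum_hitProb_le_one (hK : ∀ x, ∑ y, K x y = 1) (n : ℕ) (j : X) :
    ∑ t ∈ Finset.range n, hitProb K i j t ≤ 1 := by
  rw [← sum_hitProb_add_survival (i := i) hK n j]
  exact le_self_add

theorem tsum_hitProb_le_one (hK : ∀ x, ∑ y, K x y = 1) (j : X) : ∑' t, hitProb K i j t ≤ 1 := by
  rw [ENNReal.tsum_eq_iSup_nat]
  exact iSup_le fun N => sum_hitProb_le_one hK N j

theorem tsum_hitProb_add_le_survival (hK : ∀ x, ∑ y, K x y = 1) (n : ℕ) (j : X) :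
    ∑' k, hitProb K i j (k + n) ≤ (kernelStep (killed K i))^[n] (fun _ => 1) j := by
  have hfin : ∑ t ∈ Finset.range n, hitProb K i j t ≠ ∞ :=
    ne_top_of_le_ne_top ENNReal.one_ne_top (sum_hitProb_le_one hK n j)
  rw [← ENNReal.add_le_add_iff_left hfin, sum_hitProb_add_survival hK n j,
    sum_range_add_tsum_nat_add]
  exact tsum_hitProb_le_one hK j

/-- If `i` is reached at some fixed time with probability bounded below uniformly in the starting
point, then its mean hitting times are finite. -/
theorem meanHittingTime_ne_top (hK : ∀ x, ∑ y, K x y = 1) {n : ℕ} {ε : ℝ≥0∞} (hε : ε ≠ 0)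
    (h : ∀ x, ε ≤ (kernelStep K)^[n] (pointMass i) x) (j : X) : meanHittingTime K i j ≠ ∞ := by
  unfold meanHittingTime
  split_ifs with hij
  · simp
  have hr : 1 - ε < 1 := ENNReal.sub_lt_self ENNReal.one_ne_top one_ne_zero hε
  -- Every block of `n + 1` steps is survived with probability at most `1 - ε`.
  have hsum : ∑' n, (kernelStep (killed K i))^[n] (fun _ => 1) j ≠ ∞ := by
    refine tsum_ne_top_of_contract (m := n + 1) hr (fun n => survival_le_one hK n j) fun k =>
      survival_add_le (fun x => ?_) k j
    have h1 := iterate_pointMass_add_survival_le (i := i) hK n x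
    refine ENNReal.le_sub_of_add_le_left ?_ ((add_le_add_left (h x) _).trans h1)
    exact ne_top_of_le_ne_top ENNReal.one_ne_top ((h x).trans (le_self_add.trans h1))
  -- Survival tends to zero, so `i` is hit almost surely and the summand with factor `∞` disappears.
  have htot : ∑' t, hitProb K i j t = 1 := by
    have t1 := ENNReal.tendsto_nat_tsum fun t => hitProb K i j t
    have t2 := t1.add (ENNReal.tendsto_atTop_zero_of_tsum_ne_top hsum)
    simp only [sum_hitProb_add_survival hK, add_zero] at t2
    exact tendsto_nhds_unique t2 tendsto_const_nhds
  rw [htot, tsub_self, mul_zero, add_zero, tsum_natCast_mul]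
  refine ne_top_of_le_ne_top hsum
    ((ENNReal.tsum_le_tsum fun n => tsum_hitProb_add_le_survival hK (n + 1) j).trans ?_)
  exact ENNReal.tsum_comp_le_tsum_of_injective (add_left_injective 1) _

/-- For `i ≠ j`, a zero first sum would mean that `i` is never hit, but then the second summand is
`∞`. -/
theorem meanHittingTime_eq_zero_iff (K : X → X → ℝ≥0∞) (i j : X) :
    meanHittingTime K i j = 0 ↔ i = j := by
  refine ⟨fun h => ?_, fun h => by simp [meanHittingTime, h]⟩
  by_contra hij
  rw [meanHittingTime, if_neg hij, add_eq_zero, ENNReal.tsum_eq_zero] at h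
  have h0 : ∀ t, hitProb K i j t = 0 := fun t => by
    rcases t with _ | t
    · rw [hitProb_eq]
      simp [pointMass, Ne.symm hij]
    · simpa using h.1 (t + 1)
  simp [h0] at h

end Chain

/-! ## Markov decision processes -/

namespace MDP

theorem sum_mul_policy {S A : Type*} [Fintype S] [Fintype A] (p : PMF S) (π : S → PMF A) :
    ∑ x : S × A, p x.1 * π x.1 x.2 = 1 := by
  have h : ∀ s, ∑ a, π s a = 1 := fun s => (tsum_fintype _).symm.trans (π s).tsum_coe
  have h' : ∑ s, p s = 1 := (tsum_fintype _).symm.trans p.tsum_coe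
  simp only [Fintype.sum_prod_type, ← Finset.mul_sum, h, mul_one, h']

variable (M : MDP.{u, v})

theorem sum_init : ∑ x, M.init x = 1 := sum_mul_policy M.ρ₀ M.π

theorem sum_trans (x : M.SA) : ∑ y, M.trans x y = 1 := sum_mul_policy (M.P x.1 x.2) M.π

theorem coe_γ_lt_one : (M.γ : ℝ≥0∞) < 1 := by exact_mod_cast M.γ_lt_one

theorem sum_modTrans (x : M.SA) : ∑ y, M.modTrans x y = 1 := by
  simp only [modTrans, Finset.sum_add_distrib, ← Finset.mul_sum, sum_init, sum_trans, mul_one]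
  exact tsub_add_cancel_of_le M.coe_γ_lt_one.le

theorem weight_ne_zero_iff {x : M.SA} : M.weight x ≠ 0 ↔ 0 < M.occupancy x := by
  have : 1 - (M.γ : ℝ≥0∞) ≠ 0 := (tsub_pos_of_lt M.coe_γ_lt_one).ne'
  simp [weight, this, pos_iff_ne_zero]

theorem sum_weight : ∑ x, M.weight x = 1 := by
  have hone : ∀ t, ∑ x, chainProb M.init M.trans t {w | w (Fin.last t) = x} = 1 := fun t => by
    have h := sum_pathProb_mul M.init M.trans (fun _ => 1) t
    rw [Function.iterate_fixed (kernelStep_one M.sum_trans)] at h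
    simp only [mul_one, sum_init] at h
    rw [← h]
    simp only [chainProb]
    rw [Finset.sum_comm]
    refine Finset.sum_congr rfl fun w _ => ?_
    rw [Finset.sum_eq_single (w (Fin.last t))]
    · simp
    · intro x _ hx
      exact Set.indicator_of_notMem (fun hw => hx hw.symm) _
    · simp
  simp only [weight, occupancy, ← Finset.mul_sum]
  rw [← Summable.tsum_finsetSum fun _ _ => ENNReal.summable]
  simp only [← Finset.mul_sum, hone, mul_one, ENNReal.tsum_geometric]
  exact ENNReal.mul_inv_cancel (tsub_pos_of_lt M.coe_γ_lt_one).ne' (by simp)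

/-- The left side keeps only the runs of the modified chain without a restart. -/
theorem pow_mul_iterate_trans_le (f : M.SA → ℝ≥0∞) (n : ℕ) (x : M.SA) :
    (M.γ : ℝ≥0∞) ^ n * (kernelStep M.trans)^[n] f x ≤ (kernelStep M.modTrans)^[n] f x := by
  induction n generalizing x with
  | zero => simp
  | succ n ih =>
    rw [Function.iterate_succ_apply', Function.iterate_succ_apply', pow_succ, mul_assoc,
      ← kernelStep_const_mul, ← kernelStep_const_mul]
    refine le_trans ?_ (kernelStep_mono (fun _ _ => le_rfl) ih x)
    refine Finset.sum_le_sum fun y _ => ?_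
    rw [modTrans, add_mul]
    refine le_trans (le_of_eq ?_) le_add_self
    ring

/-- Occupied pairs have finite mean hitting times. -/
theorem T_ne_top {i : M.SA} (hi : M.weight i ≠ 0) (j : M.SA) : M.T i j ≠ ∞ := by
  rw [weight_ne_zero_iff, occupancy, pos_iff_ne_zero, Ne, ENNReal.tsum_eq_zero] at hi
  push Not at hi
  obtain ⟨t, ht⟩ := hi
  -- The bound is one restart step, then `t` steps without restart from the initial distribution; it
  -- does not depend on the starting state.
  refine meanHittingTime_ne_top M.sum_modTrans (n := t + 1)
    (mul_ne_zero (tsub_pos_of_lt M.coe_γ_lt_one).ne' ht) (fun x => ?_) j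
  rw [chainProb_last, Function.iterate_succ_apply', Finset.mul_sum, Finset.mul_sum]
  refine Finset.sum_le_sum fun y _ => ?_
  calc _ = (1 - (M.γ : ℝ≥0∞)) * M.init y *
        ((M.γ : ℝ≥0∞) ^ t * (kernelStep M.trans)^[t] (pointMass i) y) := by ring
    _ ≤ _ := mul_le_mul' le_self_add (M.pow_mul_iterate_trans_le _ t y)

theorem T_eq_zero_iff (i j : M.SA) : M.T i j = 0 ↔ i = j := meanHittingTime_eq_zero_iff _ i j

end MDP

/-! ## The Gromov-Wasserstein distance between processes -/

namespace MDP

variable (M N L : MDP.{u, v})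

theorem exists_gwCost_eq_GW : ∃ μ ∈ couplings M.weight N.weight, gwCost M.T N.T μ = GW M N :=
  exists_gwCost_eq_iInf M.sum_weight N.sum_weight (fun _ x' h => M.T_ne_top h x')
    fun _ y' h => N.T_ne_top h y'

theorem GW_ne_top : GW M N ≠ ∞ := by
  obtain ⟨μ, hμ, h⟩ := exists_gwCost_eq_GW M N
  rw [← h]
  exact gwCost_ne_top M.sum_weight (fun _ x' h => M.T_ne_top h x')
    (fun _ y' h => N.T_ne_top h y') hμ

theorem GW_comm : GW M N = GW N M := by
  have h : ∀ M N : MDP.{u, v}, GW M N ≤ GW N M := fun M N => by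
    obtain ⟨μ, hμ, h⟩ := exists_gwCost_eq_GW N M
    rw [← h, ← gwCost_swap]
    exact iInf₂_le _ (swap_mem_couplings hμ)
  exact le_antisymm (h M N) (h N M)

theorem GW_triangle : GW M L ≤ GW M N + GW N L := by
  obtain ⟨μ, hμ, h1⟩ := exists_gwCost_eq_GW M N
  obtain ⟨ν, hν, h2⟩ := exists_gwCost_eq_GW N L
  obtain ⟨σ, hσ, h3⟩ := exists_gwCost_le_add (TX := M.T) (TY := N.T) (TZ := L.T)
    (ne_top_of_sum_eq_one N.sum_weight) hμ hν
  rw [← h1, ← h2]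
  exact (iInf₂_le σ hσ).trans h3

/-- Attainment turns a zero infimum into an actual coupling of cost zero. -/
theorem GW_eq_zero_iff : GW M N = 0 ↔ sameTripleOnSupp M N := by
  have hs : ∀ (M : MDP.{u, v}) (x : M.SA), x ∈ M.supp ↔ M.weight x ≠ 0 := fun M x =>
    M.weight_ne_zero_iff.symm
  constructor
  · intro h
    obtain ⟨μ, hμ, h1⟩ := exists_gwCost_eq_GW M N
    exact exists_equiv_of_gwCost_eq_zero M.T_eq_zero_iff N.T_eq_zero_iff (hs M) (hs N) hμ
      (h1.trans h)
  · rintro ⟨φ, hT, hφ⟩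
    obtain ⟨μ, hμ, h1⟩ := exists_gwCost_eq_zero_of_equiv (hs M) (hs N) φ hT hφ
    exact nonpos_iff_eq_zero.1 (h1 ▸ iInf₂_le μ hμ)

variable {M N} in
theorem sameTriple_iff_sameTripleOnSupp (hM : M.FullyOccupied) (hN : N.FullyOccupied) :
    sameTriple M N ↔ sameTripleOnSupp M N := by
  constructor
  · rintro ⟨φ, hT, hφ⟩
    exact ⟨φ.subtypeEquiv fun x => iff_of_true (hM x) (hN _), fun x x' => hT x x', fun x => hφ x⟩
  · rintro ⟨φ, hT, hφ⟩
    exact ⟨(Equiv.subtypeUnivEquiv hM).symm.trans (φ.trans (Equiv.subtypeUnivEquiv hN)),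
      fun x x' => hT ⟨x, hM x⟩ ⟨x', hM x'⟩, fun x => hφ ⟨x, hM x⟩⟩

end MDP

/-- A finite pseudodistance induces a distance on the quotient by its kernel. -/
theorem exists_isDistance_quotient {α : Type*} (s : Setoid α) (g : α → α → ℝ≥0∞)
    (hfin : ∀ x y, g x y ≠ ∞) (hzero : ∀ x y, g x y = 0 ↔ s x y)
    (hsymm : ∀ x y, g x y = g y x) (htri : ∀ x y z, g x z ≤ g x y + g y z) :
    ∃ d : Quotient s → Quotient s → ℝ, IsDistance d ∧
      ∀ x y, g x y = ENNReal.ofReal (d (Quotient.mk s x) (Quotient.mk s y)) := by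
  -- The triangle inequality makes `g` constant on classes.
  have hle : ∀ x x' y y', s x x' → s y y' → g x y ≤ g x' y' := fun x x' y y' hx hy => by
    calc g x y ≤ g x x' + (g x' y' + g y' y) :=
          (htri x x' y).trans (add_le_add_right (htri x' y' y) _)
      _ = g x' y' := by rw [(hzero x x').2 hx, (hzero y' y).2 (s.symm hy), zero_add, add_zero]
  refine ⟨Quotient.lift₂ (fun x y => (g x y).toReal) fun x y x' y' hx hy =>
    congrArg ENNReal.toReal (le_antisymm (hle x x' y y' hx hy)
      (hle x' x y' y (s.symm hx) (s.symm hy))), ⟨?_, ?_, ?_, ?_⟩, fun x y => ?_⟩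
  · rintro ⟨x⟩ ⟨y⟩
    exact ENNReal.toReal_nonneg
  · rintro ⟨x⟩ ⟨y⟩
    refine Iff.trans ?_ ((hzero x y).trans Quotient.eq.symm)
    exact (ENNReal.toReal_eq_zero_iff _).trans (or_iff_left (hfin x y))
  · rintro ⟨x⟩ ⟨y⟩
    exact congrArg ENNReal.toReal (hsymm x y)
  · rintro ⟨x⟩ ⟨y⟩ ⟨z⟩
    exact ENNReal.toReal_le_add (htri x y z) (hfin x y) (hfin y z)
  · exact (ENNReal.ofReal_toReal (hfin x y)).symm

theorem theorem1 :
    -- the minimum over couplings is attained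
    (∀ M N : MDP.{u, v}, ∃ μ ∈ couplings M.weight N.weight, gwCost M.T N.T μ = MDP.GW M N) ∧
    -- `GW` is a distance on fully occupied processes modulo bijections of state-action pairs
    (∃ d : Quotient MDP.sameTripleFull.{u, v} → Quotient MDP.sameTripleFull.{u, v} → ℝ,
      IsDistance d ∧
      ∀ M N : {M : MDP.{u, v} // M.FullyOccupied},
        MDP.GW M.1 N.1 = ENNReal.ofReal
          (d (Quotient.mk MDP.sameTripleFull M) (Quotient.mk MDP.sameTripleFull N))) ∧
    -- `GW` is a distance on all processes modulo bijections of occupied state-action pairs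
    (∃ d : Quotient MDP.sameTripleOnSupp.{u, v} → Quotient MDP.sameTripleOnSupp.{u, v} → ℝ,
      IsDistance d ∧
      ∀ M N : MDP.{u, v},
        MDP.GW M N = ENNReal.ofReal
          (d (Quotient.mk MDP.sameTripleOnSupp M) (Quotient.mk MDP.sameTripleOnSupp N))) := by
  refine ⟨MDP.exists_gwCost_eq_GW, ?_, ?_⟩
  · exact exists_isDistance_quotient MDP.sameTripleFull (fun M N => MDP.GW M.1 N.1)
      (fun M N => MDP.GW_ne_top M.1 N.1)
      (fun M N => (MDP.GW_eq_zero_iff M.1 N.1).trans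
        (MDP.sameTriple_iff_sameTripleOnSupp M.2 N.2).symm)
      (fun M N => MDP.GW_comm M.1 N.1) fun M N L => MDP.GW_triangle M.1 N.1 L.1
  · exact exists_isDistance_quotient MDP.sameTripleOnSupp MDP.GW MDP.GW_ne_top MDP.GW_eq_zero_iff
      MDP.GW_comm MDP.GW_triangle
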